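/- Let $\mathbb K$ be a field and let $\mathcal S$ be a numerical semigroup, i.e. a submonoid of $(\mathbb N,+)$ with finite complement, with minimal generating set $\{a_1,\dots,a_m\}$ (the $a_i$ pairwise distinct). Call $\mathcal S$ free if, for some arrangement $b_1,\dots,b_m$ of its minimal generators, $$\operatorname{lcm}\bigl(b_i,\gcd(b_{i+1},\dots,b_m)\bigr)\in\langle b_{i+1},\dots,b_m\rangle\quad\text{for all } 1\le i\le m-1 .$$ Let $I_{\mathcal S}\subseteq\mathbb K[x_1,\dots,x_m]$ be the toric ideal of $\mathcal S$, generated by all binomials $x^u-x^v$ with $u,v\in\mathbb N^m$ and $\sum_i u_ia_i=\sum_i v_ia_i$; for a monomial order $\prec$ let $\operatorname{in}_\prec(I_{\mathcal S})$ be the ideal generated by the leading terms of the elements of $I_{\mathcal S}$. A Gröbner basis of $I_{\mathcal S}$ for $\prec$ is a finite subset of $I_{\mathcal S}$ whose leading terms generate $\operatorname{in}_\prec(I_{\mathcal S})$, and an ideal is a complete intersection if it has a generating set with as many elements as its height. Then the following are equivalent: 1. $\mathcal S$ is free; 2. for some monomial order $\prec$, $I_{\mathcal S}$ has a Gröbner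 basis with exactly $m-1$ elements; 3. for some monomial order $\prec$, the initial ideal $\operatorname{in}_\prec(I_{\mathcal S})$ is a complete intersection. -/

import Mathlib

/-- A numerical semigroup: a submonoid of `(ℕ, +)` with finite complement. -/
def IsNumericalSemigroup (S : AddSubmonoid ℕ) : Prop :=
  ((S : Set ℕ)ᶜ).Finite

/-- `a 0, …, a (m-1)` is an arrangement (an enumeration without repetition) of a minimal
generating set of `S`: the set of the `a i` generates `S` and no proper subset of it does. -/
structure IsMinGenArrangement (S : AddSubmonoid ℕ) {m : ℕ} (a : Fin m → ℕ) : Prop where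
  injective : Function.Injective a
  minimal : Minimal (fun B : Set ℕ => AddSubmonoid.closure B = S) (Set.range a)

/-- The freeness condition for the arrangement `a 0, …, a (m-1)`: for every index `i` except the
last one, `lcm (a i, gcd (a (i+1), …, a (m-1)))` lies in the monoid generated by
`a (i+1), …, a (m-1)`. -/
def IsFreeArrangement {m : ℕ} (a : Fin m → ℕ) : Prop :=
  ∀ i : Fin m, (i : ℕ) + 1 < m →
    Nat.lcm (a i) ((Finset.Ioi i).gcd a) ∈ AddSubmonoid.closure (a '' Set.Ioi i)

/-- `S` is free if it is free for some arrangement of its minimal generating set. -/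
def IsFreeSemigroup (S : AddSubmonoid ℕ) : Prop :=
  ∃ (m : ℕ) (a : Fin m → ℕ), IsMinGenArrangement S a ∧ IsFreeArrangement a

/-- The toric ideal of `a 0, …, a (m-1)`: the ideal generated by all binomials `x^u - x^v`
with `∑ u i * a i = ∑ v i * a i`. -/
noncomputable def toricIdeal (K : Type*) [Field K] {m : ℕ} (a : Fin m → ℕ) :
    Ideal (MvPolynomial (Fin m) K) :=
  Ideal.span {f | ∃ u v : Fin m →₀ ℕ, Finsupp.weight a u = Finsupp.weight a v ∧
    f = MvPolynomial.monomial u 1 - MvPolynomial.monomial v 1}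

/-- The initial ideal of `I`: the ideal generated by the leading terms of the elements of `I`. -/
noncomputable def initialIdeal {K : Type*} [Field K] {m : ℕ} (ord : MonomialOrder (Fin m))
    (I : Ideal (MvPolynomial (Fin m) K)) : Ideal (MvPolynomial (Fin m) K) :=
  Ideal.span (ord.leadingTerm '' (I : Set (MvPolynomial (Fin m) K)))

/-- `G` is a Gröbner basis of `I`: `G ⊆ I` and the leading terms of the elements of `G` generate
the initial ideal of `I`. -/
def IsGroebnerBasis {K : Type*} [Field K] {m : ℕ} (ord : MonomialOrder (Fin m))
    (I : Ideal (MvPolynomial (Fin m) K)) (G : Set (MvPolynomial (Fin m) K)) : Prop :=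
  G ⊆ (I : Set (MvPolynomial (Fin m) K)) ∧
    Ideal.span (ord.leadingTerm '' G) = initialIdeal ord I

/-- `I` is a complete intersection: it has a set of generators with as many elements as its
height. -/
def IsCompleteIntersection {R : Type*} [CommRing R] (I : Ideal R) : Prop :=
  ∃ s : Finset R, Ideal.span (s : Set R) = I ∧ (s.card : ℕ∞) = I.height

open MvPolynomial MonomialOrder

/-! ### Minimal generating sets of submonoids of `ℕ` -/

/-! Everything is read off `nonMinimalExponents`, the exponents that are not least in their weight
fibre: they are exactly the exponents of the monomials of the initial ideal
(`initialIdeal_toricIdeal`), and every fibre contains exactly one standard (least) exponent. Each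
condition of the theorem amounts to a box shape: for some variable `r`, the standard exponents are
those with `u i < c i` for all `i ≠ r`, with `u r` unrestricted.

Free gives a box: for lex along the arrangement, `c i * a i` is the lcm in the freeness condition.
The initial ideal is then generated by `m - 1` pure powers, hence is a complete intersection and is
realised by `m - 1` binomials.

Few generators give a box: some `r` has no pure power in the initial ideal, while every other
variable has one. Those `m - 1` powers are minimal monomials, so `m - 1` generators leave no room
for another (`exists_box`). A complete intersection has at most `m - 1` generators in a suitable set
because its height is at most `m - 1`.

A box gives free: rewrite each corner `c i` of the box as a smaller `v i` of the same weight. "`v i`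
involves `j`" is acyclic, so the variables can be ordered with `v i` using only later ones;
uniqueness of standard exponents then forces `c i * a i` to be the lcm (`lcm_mem_closure_of_box`).
-/

theorem AddSubmonoid.mem_closure_setOf_le {B : Set ℕ} {x : ℕ} (hx : x ∈ AddSubmonoid.closure B) :
    x ∈ AddSubmonoid.closure {b ∈ B | b ≤ x} := by
  induction hx using AddSubmonoid.closure_induction with
  | mem b hb => exact AddSubmonoid.subset_closure ⟨hb, le_rfl⟩
  | zero => exact zero_mem _
  | add y z _ _ hy hz =>
    refine add_mem (AddSubmonoid.closure_mono ?_ hy) (AddSubmonoid.closure_mono ?_ hz)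
    · exact fun b hb => ⟨hb.1, hb.2.trans (Nat.le_add_right y z)⟩
    · exact fun b hb => ⟨hb.1, hb.2.trans (Nat.le_add_left z y)⟩

theorem notMem_closure_diff_of_minimal {S : AddSubmonoid ℕ} {B : Set ℕ}
    (hB : Minimal (fun B : Set ℕ => AddSubmonoid.closure B = S) B) {x : ℕ} (hx : x ∈ B) :
    x ∉ AddSubmonoid.closure (B \ {x}) := by
  intro hmem
  have hcl : AddSubmonoid.closure (B \ {x}) = S := by
    rw [← hB.prop]
    refine le_antisymm (AddSubmonoid.closure_mono Set.sdiff_subset) ?_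
    rw [AddSubmonoid.closure_le]
    intro b hb
    by_cases h : b = x
    · exact h ▸ hmem
    · exact AddSubmonoid.subset_closure ⟨hb, h⟩
  exact (hB.le_of_le hcl Set.sdiff_subset hx).2 rfl

/-- The atoms of `S` depend on `S` alone, so all minimal generating sets coincide and freeness can
be tested on permutations of a given one. -/
theorem mem_iff_of_minimal {S : AddSubmonoid ℕ} {B : Set ℕ}
    (hB : Minimal (fun B : Set ℕ => AddSubmonoid.closure B = S) B) (x : ℕ) :
    x ∈ B ↔ x ∈ S ∧ x ≠ 0 ∧ ∀ y ∈ S, ∀ z ∈ S, x = y + z → y = 0 ∨ z = 0 := by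
  have hcl : AddSubmonoid.closure B = S := hB.prop
  constructor
  · intro hx
    have hnot := notMem_closure_diff_of_minimal hB hx
    refine ⟨hcl ▸ AddSubmonoid.subset_closure hx, ?_, ?_⟩
    · rintro rfl
      exact hnot (zero_mem _)
    · intro y hy z hz hyz
      by_contra! hne
      apply hnot
      have key : ∀ w ∈ S, w < x → w ∈ AddSubmonoid.closure (B \ {x}) := by
        intro w hw hwx
        rw [← hcl] at hw
        refine AddSubmonoid.closure_mono ?_ (AddSubmonoid.mem_closure_setOf_le hw)
        exact fun b hb => ⟨hb.1, fun h => by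
          have := hb.2
          rw [Set.mem_singleton_iff] at h
          omega⟩
      have h := add_mem (key y hy (by omega)) (key z hz (by omega))
      rwa [← hyz] at h
  · rintro ⟨hxS, hx0, hat⟩
    have key : ∀ w ∈ AddSubmonoid.closure B,
        w = 0 ∨ w ∈ B ∨ ∃ y ∈ S, ∃ z ∈ S, y ≠ 0 ∧ z ≠ 0 ∧ w = y + z := by
      intro w hw
      induction hw using AddSubmonoid.closure_induction with
      | mem b hb => exact Or.inr (Or.inl hb)
      | zero => exact Or.inl rfl
      | add y z hy hz ihy ihz =>
        rcases eq_or_ne y 0 with rfl | hy0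
        · simpa using ihz
        rcases eq_or_ne z 0 with rfl | hz0
        · simpa using ihy
        exact Or.inr (Or.inr ⟨y, hcl ▸ hy, z, hcl ▸ hz, hy0, hz0, rfl⟩)
    rcases key x (hcl ▸ hxS) with h | h | ⟨y, hy, z, hz, hy0, hz0, h⟩
    · exact absurd h hx0
    · exact h
    · rcases hat y hy z hz h with h | h <;> contradiction

theorem IsMinGenArrangement.pos {S : AddSubmonoid ℕ} {m : ℕ} {a : Fin m → ℕ}
    (ha : IsMinGenArrangement S a) (i : Fin m) : 0 < a i :=
  Nat.pos_of_ne_zero ((mem_iff_of_minimal ha.minimal (a i)).1 ⟨i, rfl⟩).2.1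

theorem IsMinGenArrangement.range_eq {S : AddSubmonoid ℕ} {m n : ℕ} {a : Fin m → ℕ}
    {b : Fin n → ℕ} (ha : IsMinGenArrangement S a) (hb : IsMinGenArrangement S b) :
    Set.range a = Set.range b := by
  ext x
  rw [mem_iff_of_minimal ha.minimal, mem_iff_of_minimal hb.minimal]

theorem IsMinGenArrangement.comp_equiv {S : AddSubmonoid ℕ} {m n : ℕ} {a : Fin m → ℕ}
    (ha : IsMinGenArrangement S a) (e : Fin n ≃ Fin m) : IsMinGenArrangement S (a ∘ e) where
  injective := ha.injective.comp e.injective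
  minimal := by
    rw [e.surjective.range_comp]
    exact ha.minimal

theorem isFreeSemigroup_iff {S : AddSubmonoid ℕ} {m : ℕ} {a : Fin m → ℕ}
    (ha : IsMinGenArrangement S a) :
    IsFreeSemigroup S ↔ ∃ e : Fin m ≃ Fin m, IsFreeArrangement (a ∘ e) := by
  constructor
  · rintro ⟨n, b, hb, hfree⟩
    have hr := hb.range_eq ha
    let f : Fin n ≃ Fin m := (Equiv.ofInjective b hb.injective).trans
      ((Equiv.setCongr hr).trans (Equiv.ofInjective a ha.injective).symm)
    have hf : ∀ i, a (f i) = b i := fun i => by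
      simp [f, Equiv.apply_ofInjective_symm]
    obtain rfl : n = m := by simpa using Fintype.card_congr f
    refine ⟨f, ?_⟩
    rwa [show a ∘ f = b from funext hf]
  · rintro ⟨e, he⟩
    exact ⟨m, a ∘ e, ha.comp_equiv e, he⟩

theorem IsNumericalSemigroup.pos_of_isMinGenArrangement {S : AddSubmonoid ℕ}
    (hS : IsNumericalSemigroup S) {m : ℕ} {a : Fin m → ℕ} (ha : IsMinGenArrangement S a) :
    0 < m := by
  by_contra h
  obtain rfl : m = 0 := by omega
  have hbot : S = ⊥ := by
    have h := ha.minimal.prop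
    rw [Set.range_eq_empty, AddSubmonoid.closure_empty] at h
    exact h.symm
  subst hbot
  exact (Set.infinite_of_injective_forall_mem (f := Nat.succ) Nat.succ_injective
    (by simp)) hS

/-! ### Height of ideals generated by powers of variables -/

section Height

variable {σ K : Type*} [Field K]

/-- Presenting the ideal as the kernel of a map to a domain makes it prime. -/
theorem MvPolynomial.ker_aeval_ite_zero_X (T : Set σ) [DecidablePred (· ∈ T)] :
    RingHom.ker (aeval (R := K) fun i => if i ∈ T then (0 : MvPolynomial σ K) else X i) =
      Ideal.span (X '' T) := by
  refine le_antisymm ?_ ?_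
  · have key : ∀ f : MvPolynomial σ K,
        f - aeval (R := K) (fun i => if i ∈ T then (0 : MvPolynomial σ K) else X i) f ∈
          Ideal.span (X '' T : Set (MvPolynomial σ K)) := by
      intro f
      rw [← Ideal.Quotient.mk_eq_mk_iff_sub_mem]
      have : (Ideal.Quotient.mkₐ K (Ideal.span (X '' T : Set (MvPolynomial σ K)))) =
          (Ideal.Quotient.mkₐ K _).comp
            (aeval (R := K) fun i => if i ∈ T then (0 : MvPolynomial σ K) else X i) := by
        ext i
        by_cases hi : i ∈ T
        · simp only [AlgHom.comp_apply, aeval_X, if_pos hi, map_zero]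
          exact Ideal.Quotient.eq_zero_iff_mem.2 (Ideal.subset_span ⟨i, hi, rfl⟩)
        · simp [hi]
      exact DFunLike.congr_fun this f
    intro f hf
    have h := key f
    rw [RingHom.mem_ker] at hf
    erw [hf] at h
    simpa using h
  · rw [Ideal.span_le]
    rintro _ ⟨i, hi, rfl⟩
    simp [RingHom.mem_ker, hi]

theorem MvPolynomial.isPrime_span_X_image (T : Set σ) :
    (Ideal.span (X '' T : Set (MvPolynomial σ K))).IsPrime := by
  classical
  rw [← ker_aeval_ite_zero_X]
  exact RingHom.ker_isPrime _

theorem MvPolynomial.card_le_height_span_X_image (T : Finset σ) :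
    (T.card : ℕ∞) ≤ (Ideal.span (X '' T : Set (MvPolynomial σ K))).height := by
  classical
  induction T using Finset.induction_on with
  | empty => simp
  | insert i T hi ih =>
    rw [Finset.card_insert_of_notMem hi, Nat.cast_add, Nat.cast_one]
    have := isPrime_span_X_image (K := K) (T : Set σ)
    have := isPrime_span_X_image (K := K) ((insert i T : Finset σ) : Set σ)
    refine le_trans (add_le_add_left ih 1) (Ideal.height_add_one_le_of_lt_of_isPrime ?_)
    refine lt_of_le_of_ne (Ideal.span_mono (Set.image_mono (by simp))) fun h => ?_
    have hX : (X i : MvPolynomial σ K) ∈ Ideal.span (X '' (T : Set σ)) := by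
      rw [h]
      exact Ideal.subset_span ⟨i, by simp, rfl⟩
    rw [mem_ideal_span_X_image] at hX
    obtain ⟨j, hj, hj0⟩ := hX (Finsupp.single i 1) (by simp [X])
    rw [Finsupp.single_apply] at hj0
    split_ifs at hj0 with hij
    · exact hi (hij ▸ hj)
    · exact hj0 rfl

theorem Ideal.height_span_le_ncard {R : Type*} [CommRing R] [IsNoetherianRing R] {s : Set R}
    (hs : s.Finite) (h : Ideal.span s ≠ ⊤) : (Ideal.span s).height ≤ s.ncard :=
  (Ideal.height_le_spanFinrank _ h).trans
    (Nat.cast_le.2 (Submodule.spanFinrank_span_le_ncard_of_finite hs))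

/-- The upper bound is Krull's height theorem; for the lower one, a prime containing the powers
contains the variables. -/
theorem MvPolynomial.height_span_monomial_single [Finite σ] (T : Finset σ) (c : σ → ℕ)
    (hc : ∀ i ∈ T, c i ≠ 0) :
    (Ideal.span ((fun i => monomial (Finsupp.single i (c i)) (1 : K)) '' (T : Set σ))).height =
      T.card := by
  have hle : Ideal.span ((fun i => monomial (Finsupp.single i (c i)) (1 : K)) '' (T : Set σ)) ≤
      Ideal.span (X '' (T : Set σ)) := by
    rw [Ideal.span_le]
    rintro _ ⟨i, hi, rfl⟩
    have hX : (X i : MvPolynomial σ K) ∈ Ideal.span (X '' (T : Set σ)) :=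
      Ideal.subset_span ⟨i, hi, rfl⟩
    simpa only [← X_pow_eq_monomial, SetLike.mem_coe] using
      Ideal.pow_mem_of_mem _ hX _ (Nat.pos_of_ne_zero (hc i hi))
  have hP := isPrime_span_X_image (K := K) (T : Set σ)
  refine le_antisymm ?_ ?_
  · refine (Ideal.height_span_le_ncard (T.finite_toSet.image _)
      fun h => hP.ne_top (top_le_iff.1 (h ▸ hle))).trans (Nat.cast_le.2 ?_)
    exact (Set.ncard_image_le T.finite_toSet).trans (Set.ncard_coe_finset T).le
  · refine (card_le_height_span_X_image (K := K) T).trans ?_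
    refine le_of_le_of_eq ?_ (Ideal.height_eq_inf_minimalPrimes _).symm
    refine le_iInf₂ fun Q hQ => ?_
    have := hQ.1.1
    refine Ideal.height_mono ?_
    rw [Ideal.span_le]
    rintro _ ⟨i, hi, rfl⟩
    refine this.mem_of_pow_mem (c i) (hQ.1.2 ?_)
    rw [X_pow_eq_monomial]
    exact Ideal.subset_span ⟨i, hi, rfl⟩

end Height

/-! ### Standard and non-standard exponents -/

section NonMinimal

variable {m : ℕ}

/-- The exponents of the monomials that are not minimal, for the monomial order `ord`, among the
monomials of the same weight. -/
def nonMinimalExponents (ord : MonomialOrder (Fin m)) (a : Fin m → ℕ) : Set (Fin m →₀ ℕ) :=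
  {u | ∃ v, Finsupp.weight a v = Finsupp.weight a u ∧ v ≺[ord] u}

theorem nonMinimalExponents_isUpperSet (ord : MonomialOrder (Fin m)) (a : Fin m → ℕ) :
    IsUpperSet (nonMinimalExponents ord a) := by
  rintro u w huw ⟨v, hv, hlt⟩
  obtain ⟨d, rfl⟩ := exists_add_of_le huw
  refine ⟨v + d, by rw [map_add, map_add, hv], ?_⟩
  rw [map_add, map_add]
  gcongr

theorem zero_notMem_nonMinimalExponents (ord : MonomialOrder (Fin m)) (a : Fin m → ℕ) :
    0 ∉ nonMinimalExponents ord a := by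
  rintro ⟨v, -, hv⟩
  rw [map_zero] at hv
  exact absurd hv (not_lt.2 (ord.zero_le _))

theorem mem_or_mem_nonMinimalExponents {ord : MonomialOrder (Fin m)} {a : Fin m → ℕ}
    {u v : Fin m →₀ ℕ} (h : Finsupp.weight a u = Finsupp.weight a v) (hne : u ≠ v) :
    u ∈ nonMinimalExponents ord a ∨ v ∈ nonMinimalExponents ord a := by
  rcases lt_or_gt_of_ne (ord.toSyn.injective.ne hne) with hlt | hlt
  · exact Or.inr ⟨u, h, hlt⟩
  · exact Or.inl ⟨v, h.symm, hlt⟩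

theorem MonomialOrder.exists_minimal (ord : MonomialOrder (Fin m)) {A : Set (Fin m →₀ ℕ)}
    (hA : A.Nonempty) : ∃ u ∈ A, ∀ v ∈ A, ¬ v ≺[ord] u := by
  have := ord.wellFoundedLT_syn
  obtain ⟨u, hu, hmin⟩ := (InvImage.wf ord.toSyn (wellFounded_lt (α := ord.syn))).has_min A hA
  exact ⟨u, hu, hmin⟩

theorem exists_notMem_nonMinimalExponents (ord : MonomialOrder (Fin m)) (a : Fin m → ℕ)
    (u : Fin m →₀ ℕ) :
    ∃ v ∉ nonMinimalExponents ord a, Finsupp.weight a v = Finsupp.weight a u := by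
  obtain ⟨v, hv, hmin⟩ := ord.exists_minimal
    (A := {v | Finsupp.weight a v = Finsupp.weight a u}) ⟨u, rfl⟩
  refine ⟨v, ?_, hv⟩
  rintro ⟨w, hw, hlt⟩
  exact hmin w (hw.trans hv) hlt

end NonMinimal

/-! ### Toric ideals and their initial ideals -/

section Toric

variable {K : Type*} [Field K] {m : ℕ}

/-- The substitution `x_i ↦ t ^ a i` kills the toric ideal; the sum is the coefficient of `t ^ d` in
the image of `f`. -/
theorem sum_coeff_eq_zero_of_mem_toricIdeal {a : Fin m → ℕ} {f : MvPolynomial (Fin m) K}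
    (hf : f ∈ toricIdeal K a) (d : ℕ) :
    ∑ u ∈ f.support with Finsupp.weight a u = d, f.coeff u = 0 := by
  have hker : toricIdeal K a ≤
      RingHom.ker (aeval (R := K) fun i => (Polynomial.X : Polynomial K) ^ a i) := by
    rw [toricIdeal, Ideal.span_le]
    rintro _ ⟨u, v, huv, rfl⟩
    have hmon : ∀ w : Fin m →₀ ℕ,
        aeval (R := K) (fun i => (Polynomial.X : Polynomial K) ^ a i) (monomial w 1) =
          Polynomial.X ^ Finsupp.weight a w := by
      intro w
      rw [aeval_monomial, map_one, one_mul, Finsupp.weight_apply, Finsupp.prod, Finsupp.sum,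
        ← Finset.prod_pow_eq_pow_sum]
      refine Finset.prod_congr rfl fun i _ => ?_
      rw [← pow_mul, smul_eq_mul, mul_comm]
    rw [SetLike.mem_coe, RingHom.mem_ker, map_sub, hmon, hmon, huv, sub_self]
  have h0 := congrArg (Polynomial.coeff · d) (RingHom.mem_ker.1 (hker hf))
  simp only [Polynomial.coeff_zero] at h0
  rw [aeval_def, eval₂_eq, Polynomial.finsetSum_coeff] at h0
  rw [Finset.sum_filter]
  refine Eq.trans (Finset.sum_congr rfl fun u _ => ?_) h0
  have : ∏ i ∈ u.support, ((Polynomial.X : Polynomial K) ^ a i) ^ u i =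
      Polynomial.X ^ Finsupp.weight a u := by
    rw [Finsupp.weight_apply, Finsupp.sum, ← Finset.prod_pow_eq_pow_sum]
    refine Finset.prod_congr rfl fun i _ => ?_
    rw [← pow_mul, smul_eq_mul, mul_comm]
  rw [this, Polynomial.algebraMap_eq, Polynomial.coeff_C_mul_X_pow]
  simp only [eq_comm]

theorem exists_mem_support_weight_eq {a : Fin m → ℕ} {f : MvPolynomial (Fin m) K}
    (hf : f ∈ toricIdeal K a) {u : Fin m →₀ ℕ} (hu : u ∈ f.support) :
    ∃ v ∈ f.support, v ≠ u ∧ Finsupp.weight a v = Finsupp.weight a u := by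
  by_contra! h
  have hsum := sum_coeff_eq_zero_of_mem_toricIdeal hf (Finsupp.weight a u)
  rw [Finset.sum_eq_single_of_mem u (by simpa using hu)] at hsum
  · exact (mem_support_iff.1 hu) hsum
  · intro v hv hvu
    rw [Finset.mem_filter] at hv
    exact absurd hv.2 (h v hv.1 hvu)

theorem monomial_sub_monomial_mem_toricIdeal {a : Fin m → ℕ} {u v : Fin m →₀ ℕ}
    (h : Finsupp.weight a u = Finsupp.weight a v) :
    (monomial u 1 - monomial v 1 : MvPolynomial (Fin m) K) ∈ toricIdeal K a :=
  Ideal.subset_span ⟨u, v, h, rfl⟩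

theorem MonomialOrder.degree_monomial_sub_monomial (ord : MonomialOrder (Fin m))
    {u v : Fin m →₀ ℕ} (h : v ≺[ord] u) :
    ord.degree (monomial u 1 - monomial v 1 : MvPolynomial (Fin m) K) = u := by
  classical
  have hu : ord.degree (monomial u (1 : K)) = u := by simp [degree_monomial]
  have hv : ord.degree (monomial v (1 : K)) = v := by simp [degree_monomial]
  rw [ord.degree_sub_of_lt (by rwa [hu, hv]), hu]

theorem MonomialOrder.leadingTerm_monomial_sub_monomial (ord : MonomialOrder (Fin m))
    {u v : Fin m →₀ ℕ} (h : v ≺[ord] u) :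
    ord.leadingTerm (monomial u 1 - monomial v 1 : MvPolynomial (Fin m) K) = monomial u 1 := by
  have hne : v ≠ u := fun h' => by simp [h'] at h
  rw [leadingTerm, leadingCoeff, ord.degree_monomial_sub_monomial h]
  simp [coeff_monomial, hne]

/-- A leading monomial cannot be alone in its weight, so another, smaller term shares it; conversely
binomials realise every non-minimal exponent. -/
theorem initialIdeal_toricIdeal (ord : MonomialOrder (Fin m)) (a : Fin m → ℕ) :
    initialIdeal ord (toricIdeal K a) =
      Ideal.span ((fun u => monomial u (1 : K)) '' nonMinimalExponents ord a) := by
  refine le_antisymm ?_ ?_ <;> rw [initialIdeal, Ideal.span_le]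
  · rintro _ ⟨f, hf, rfl⟩
    rcases eq_or_ne f 0 with rfl | hf0
    · simp
    obtain ⟨v, hv, hne, hw⟩ := exists_mem_support_weight_eq hf (ord.degree_mem_support hf0)
    rw [leadingTerm, ← mul_one (ord.leadingCoeff f), ← C_mul_monomial]
    refine Ideal.mul_mem_left _ _ (Ideal.subset_span ⟨_, ⟨v, hw, ?_⟩, rfl⟩)
    exact lt_of_le_of_ne (ord.le_degree hv) (ord.toSyn.injective.ne hne)
  · rintro _ ⟨u, ⟨v, hw, hlt⟩, rfl⟩
    exact Ideal.subset_span ⟨_, monomial_sub_monomial_mem_toricIdeal hw.symm,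
      ord.leadingTerm_monomial_sub_monomial hlt⟩

theorem IsUpperSet.mem_span_monomial_iff {σ : Type*} {A : Set (σ →₀ ℕ)} (hA : IsUpperSet A)
    {f : MvPolynomial σ K} :
    f ∈ Ideal.span ((fun u => monomial u (1 : K)) '' A) ↔ ∀ u ∈ f.support, u ∈ A := by
  rw [mem_ideal_span_monomial_image]
  exact forall₂_congr fun u _ => ⟨fun ⟨v, hv, hvu⟩ => hA hvu hv, fun hu => ⟨u, hu, le_rfl⟩⟩

/-- A generating set of a monomial ideal has at least as many elements as there are minimal
monomials in the ideal. -/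
theorem card_le_card_of_span_eq_span_monomial {σ ι : Type*} [Fintype ι] {A : Set (σ →₀ ℕ)}
    (hA : IsUpperSet A) {s : Finset (MvPolynomial σ K)}
    (hs : Ideal.span (s : Set (MvPolynomial σ K)) =
      Ideal.span ((fun u => monomial u (1 : K)) '' A))
    {τ : ι → σ →₀ ℕ} (hτ : Function.Injective τ) (hmin : ∀ i, Minimal (· ∈ A) (τ i)) :
    Fintype.card ι ≤ s.card := by
  classical
  -- By minimality of the `τ i`, only the constant term of `p` matters in `Φ (p * f)`, so ideal
  -- generators map to `K`-linear generators of `ι → K`.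
  let Φ : MvPolynomial σ K →ₗ[K] ι → K := LinearMap.pi fun i => lcoeff K (τ i)
  have hΦ : ∀ f i, Φ f i = f.coeff (τ i) := fun f i => rfl
  have hmul : ∀ p f : MvPolynomial σ K, f ∈ Ideal.span (s : Set (MvPolynomial σ K)) →
      Φ (p * f) = p.coeff 0 • Φ f := by
    intro p f hf
    rw [hs, hA.mem_span_monomial_iff] at hf
    ext i
    rw [Pi.smul_apply, hΦ, hΦ, coeff_mul, smul_eq_mul,
      Finset.sum_eq_single_of_mem (0, τ i) (by simp)]
    rintro ⟨d, e⟩ hde hne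
    rw [Finset.HasAntidiagonal.mem_antidiagonal] at hde
    by_cases he : e ∈ f.support
    · have hle : e ≤ τ i := hde ▸ le_add_self
      have heq : e = τ i := le_antisymm hle ((hmin i).le_of_le (hf e he) hle)
      subst heq
      exact absurd (by simpa using hde) (fun h : d = 0 => hne (by rw [h]))
    · rw [notMem_support_iff.1 he, mul_zero]
  have hspan : ∀ f ∈ Ideal.span (s : Set (MvPolynomial σ K)),
      Φ f ∈ Submodule.span K (Φ '' s) := by
    intro f hf
    induction hf using Submodule.span_induction with
    | mem x hx => exact Submodule.subset_span ⟨x, hx, rfl⟩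
    | zero => simp
    | add x y _ _ hx hy => rw [map_add]; exact add_mem hx hy
    | smul p x hx ih =>
      rw [smul_eq_mul, hmul p x hx]
      exact Submodule.smul_mem _ _ ih
  have htop : Submodule.span K (Φ '' (s : Set (MvPolynomial σ K))) = ⊤ := by
    rw [eq_top_iff, ← (Pi.basisFun K ι).span_eq, Submodule.span_le]
    rintro _ ⟨i, rfl⟩
    have : Pi.basisFun K ι i = Φ (monomial (τ i) 1) := by
      ext j
      rw [hΦ, coeff_monomial, Pi.basisFun_apply, Pi.single_apply]
      simp [hτ.eq_iff, eq_comm]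
    rw [this]
    refine hspan _ ?_
    rw [hs]
    exact Ideal.subset_span ⟨_, (hmin i).prop, rfl⟩
  calc Fintype.card ι = Module.finrank K (ι → K) := (Module.finrank_fintype_fun_eq_card K).symm
    _ = Module.finrank K (Submodule.span K ((s.image Φ : Finset (ι → K)) : Set (ι → K))) := by
      rw [Finset.coe_image, htop, finrank_top]
    _ ≤ (s.image Φ).card := finrank_span_finset_le_card _
    _ ≤ s.card := Finset.card_image_le

end Toric

/-! ### The box shape of the standard exponents -/

section Box

variable {m : ℕ} {ord : MonomialOrder (Fin m)} {a : Fin m → ℕ}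

/-- Pure powers of all variables would leave finitely many standard exponents, but infinitely many
weights occur. -/
theorem exists_single_notMem_nonMinimalExponents (hm : 0 < m) (ha : ∀ i, 0 < a i) :
    ∃ r, ∀ n, Finsupp.single r n ∉ nonMinimalExponents ord a := by
  by_contra! h
  choose N hN using h
  choose f hf hw using fun n : ℕ =>
    exists_notMem_nonMinimalExponents ord a (Finsupp.single ⟨0, hm⟩ n)
  have hinj : Function.Injective f := by
    intro n k hnk
    have h := hw n
    rw [hnk, hw k, Finsupp.weight_single, Finsupp.weight_single, smul_eq_mul, smul_eq_mul] at h
    exact (Nat.eq_of_mul_eq_mul_right (ha _) h).symm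
  refine (Set.infinite_of_injective_forall_mem hinj (s := Set.Iic (Finsupp.equivFunOnFinite.symm N))
    fun n i => ?_) (Set.finite_Iic _)
  by_contra hlt
  refine hf n (nonMinimalExponents_isUpperSet ord a ?_ (hN i))
  rw [Finsupp.single_le_iff]
  simpa using (not_le.1 hlt).le

/-- Every monomial of the initial ideal involves a variable other than `r`, so the ideal lies in a
prime generated by `m - 1` variables. -/
theorem height_initialIdeal_add_one_le {K : Type*} [Field K] {r : Fin m}
    (hr : ∀ n, Finsupp.single r n ∉ nonMinimalExponents ord a) :
    (initialIdeal ord (toricIdeal K a)).height + 1 ≤ m := by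
  have hP := isPrime_span_X_image (K := K) ((Finset.univ.erase r : Finset (Fin m)) : Set (Fin m))
  have hle : initialIdeal ord (toricIdeal K a) ≤
      Ideal.span (X '' ((Finset.univ.erase r : Finset (Fin m)) : Set (Fin m))) := by
    rw [initialIdeal_toricIdeal]
    intro f hf
    rw [(nonMinimalExponents_isUpperSet ord a).mem_span_monomial_iff] at hf
    rw [mem_ideal_span_X_image]
    intro u hu
    by_contra! h
    refine hr (u r) ?_
    have : u = Finsupp.single r (u r) := by
      ext i
      by_cases hi : i = r
      · simp [hi]
      · rw [h i (by simpa using hi), Finsupp.single_eq_of_ne hi]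
    exact this ▸ hf u hu
  have h := (Ideal.height_mono hle).trans
    (Ideal.height_span_le_ncard ((Finset.finite_toSet _).image _) hP.ne_top)
  have hcard := (Set.ncard_image_le (f := (X : Fin m → MvPolynomial (Fin m) K))
    (Finset.finite_toSet (Finset.univ.erase r))).trans (Set.ncard_coe_finset _).le
  rw [Finset.card_erase_of_mem (Finset.mem_univ r), Finset.card_univ, Fintype.card_fin] at hcard
  have hm := r.pos
  calc _ ≤ ((m - 1 : ℕ) : ℕ∞) + 1 := add_le_add_left (h.trans (Nat.cast_le.2 hcard)) 1
    _ = m := by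
      exact_mod_cast congrArg (Nat.cast (R := ℕ∞)) (Nat.sub_add_cancel hm)

theorem exists_box {K : Type*} [Field K] (ha : ∀ i, 0 < a i) {r : Fin m}
    (hr : ∀ n, Finsupp.single r n ∉ nonMinimalExponents ord a) {s : Finset (MvPolynomial (Fin m) K)}
    (hs : Ideal.span (s : Set (MvPolynomial (Fin m) K)) = initialIdeal ord (toricIdeal K a))
    (hcard : s.card + 1 ≤ m) :
    ∃ c : Fin m → ℕ, ∀ u, u ∈ nonMinimalExponents ord a ↔ ∃ i, i ≠ r ∧ c i ≤ u i := by
  classical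
  have hup := nonMinimalExponents_isUpperSet ord a
  have hex : ∀ i, ∃ c, i ≠ r → Minimal (fun n => Finsupp.single i n ∈ nonMinimalExponents ord a) c := by
    intro i
    by_cases hi : i = r
    · exact ⟨0, fun h => absurd hi h⟩
    have : ∃ n, Finsupp.single i n ∈ nonMinimalExponents ord a := by
      -- `x_i ^ a r` and `x_r ^ a i` have equal weight, and the latter is standard.
      refine ⟨a r, (mem_or_mem_nonMinimalExponents (v := Finsupp.single r (a i)) ?_ ?_).resolve_right
        (hr _)⟩
      · simp [Finsupp.weight_single, mul_comm]
      · intro h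
        have := DFunLike.congr_fun h i
        rw [Finsupp.single_eq_same, Finsupp.single_eq_of_ne hi] at this
        exact (ha r).ne' this
    exact ⟨Nat.find this, fun _ => ⟨Nat.find_spec this, fun n hn _ => Nat.find_min' this hn⟩⟩
  choose c hc using hex
  refine ⟨c, fun u => ⟨fun hu => ?_, fun ⟨i, hi, hle⟩ =>
    hup (Finsupp.single_le_iff.2 hle) (hc i hi).prop⟩⟩
  by_contra! hlt
  obtain ⟨w, hwu, hw⟩ := exists_minimal_le_of_wellFoundedLT (· ∈ nonMinimalExponents ord a) u hu
  have hwlt : ∀ i, i ≠ r → w i < c i := fun i hi => (hwu i).trans_lt (hlt i hi)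
  -- The extra minimal exponent `w` fills the free slot `r`, giving `m` minimal monomials against
  -- fewer than `m` generators.
  let τ : Fin m → Fin m →₀ ℕ := fun i => if i = r then w else Finsupp.single i (c i)
  have hτr : τ r = w := if_pos rfl
  have hτ : ∀ i, i ≠ r → τ i = Finsupp.single i (c i) := fun i hi => if_neg hi
  have hinj : Function.Injective τ := by
    have aux : ∀ i j, i ≠ r → τ i = τ j → i = j := by
      intro i j hi h
      rw [hτ i hi] at h
      by_contra hij
      have hi' := DFunLike.congr_fun h i
      rw [Finsupp.single_eq_same] at hi'
      by_cases hj : j = r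
      · rw [hj, hτr] at hi'
        exact (hwlt i hi).ne hi'.symm
      · rw [hτ j hj, Finsupp.single_eq_of_ne hij] at hi'
        have h0 := (hc i hi).prop
        simp only [hi', Finsupp.single_zero] at h0
        exact zero_notMem_nonMinimalExponents ord a h0
    intro i j h
    by_cases hi : i = r
    · by_cases hj : j = r
      · rw [hi, hj]
      · exact (aux j i hj h.symm).symm
    · exact aux i j hi h
  have hmin : ∀ i, Minimal (· ∈ nonMinimalExponents ord a) (τ i) := by
    intro i
    by_cases hi : i = r
    · rw [hi, hτr]
      exact hw
    · rw [hτ i hi]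
      refine ⟨(hc i hi).prop, fun e he hle => ?_⟩
      have heq : e = Finsupp.single i (e i) := by
        ext j
        by_cases hj : j = i
        · simp [hj]
        · have := hle j
          rw [Finsupp.single_eq_of_ne hj] at this ⊢
          exact Nat.le_zero.1 this
      rw [Finsupp.single_le_iff]
      refine (hc i hi).le_of_le (y := e i) (heq ▸ he) ?_
      simpa using hle i
  have := card_le_card_of_span_eq_span_monomial hup (hs.trans (initialIdeal_toricIdeal ord a))
    hinj hmin
  rw [Fintype.card_fin] at this
  omega

/-! ### Submonoids generated by some of the weights -/

theorem weight_mem_closure {T : Set (Fin m)} {w : Fin m →₀ ℕ} (hw : ∀ i, w i ≠ 0 → i ∈ T) :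
    Finsupp.weight a w ∈ AddSubmonoid.closure (a '' T) := by
  rw [Finsupp.weight_apply]
  exact sum_mem fun i hi => nsmul_mem (AddSubmonoid.subset_closure
    (Set.mem_image_of_mem a (hw i (Finsupp.mem_support_iff.1 hi)))) _

theorem exists_weight_eq_of_mem_closure {T : Set (Fin m)} {x : ℕ}
    (hx : x ∈ AddSubmonoid.closure (a '' T)) :
    ∃ w : Fin m →₀ ℕ, (∀ i, w i ≠ 0 → i ∈ T) ∧ Finsupp.weight a w = x := by
  induction hx using AddSubmonoid.closure_induction with
  | mem _ h =>
    obtain ⟨i, hi, rfl⟩ := h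
    refine ⟨Finsupp.single i 1, fun j hj => ?_, by simp [Finsupp.weight_single]⟩
    rw [Finsupp.single_apply_ne_zero] at hj
    exact hj.1 ▸ hi
  | zero => exact ⟨0, by simp, map_zero _⟩
  | add y z _ _ hy hz =>
    obtain ⟨u, hu, rfl⟩ := hy
    obtain ⟨v, hv, rfl⟩ := hz
    refine ⟨u + v, fun i hi => ?_, map_add _ _ _⟩
    by_cases h : u i = 0
    · exact hv i (by simpa [h] using hi)
    · exact hu i h

/-- A multiple of the greatest common divisor of a set of generators lies in the generated monoid
up to adding a multiple of one of the generators. -/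
theorem exists_add_mul_mem_closure {T : Finset (Fin m)} {r : Fin m} (hr : r ∈ T) (hpos : 0 < a r)
    {x : ℕ} (hx : T.gcd a ∣ x) :
    ∃ N, x + N * a r ∈ AddSubmonoid.closure (a '' (T : Set (Fin m))) := by
  let M := AddSubmonoid.closure (a '' (T : Set (Fin m)))
  have har : a r ∈ M := AddSubmonoid.subset_closure ⟨r, hr, rfl⟩
  let H : AddSubgroup ℤ :=
    { carrier := {y | ∃ N : ℕ, ∃ z ∈ M, y + N * a r = z}
      zero_mem' := ⟨0, 0, zero_mem _, by simp⟩
      add_mem' := by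
        rintro y y' ⟨N, z, hz, h⟩ ⟨N', z', hz', h'⟩
        refine ⟨N + N', z + z', add_mem hz hz', ?_⟩
        push_cast
        linear_combination h + h'
      neg_mem' := by
        rintro y ⟨N, z, hz, h⟩
        -- From `y + N * a r = z` follows `-y + z * a r = N * a r + (a r - 1) * z`.
        refine ⟨z, N * a r + (a r - 1) * z, add_mem (nsmul_mem har N) (nsmul_mem hz _), ?_⟩
        push_cast [Nat.cast_sub (show 1 ≤ a r from hpos)]
        linear_combination -h }
  obtain ⟨d, hd⟩ := Int.subgroup_cyclic H
  rw [← AddSubgroup.zmultiples_eq_closure] at hd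
  have hdvd : d.natAbs ∣ T.gcd a := Finset.dvd_gcd fun j hj => by
    have hjH : (a j : ℤ) ∈ H := ⟨0, a j, AddSubmonoid.subset_closure ⟨j, hj, rfl⟩, by simp⟩
    rw [hd, Int.mem_zmultiples_iff] at hjH
    exact Int.natAbs_dvd_natAbs.2 hjH
  have hxH : (x : ℤ) ∈ H := by
    rw [hd, Int.mem_zmultiples_iff]
    exact Int.natAbs_dvd.1 (Int.natCast_dvd_natCast.2 (hdvd.trans hx))
  obtain ⟨N, z, hz, h⟩ := hxH
  refine ⟨N, ?_⟩
  have : x + N * a r = z := by exact_mod_cast h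
  rwa [this]

/-! ### From a box to a free arrangement -/

variable {r : Fin m} {c : Fin m → ℕ}

/-- Acyclicity: multiply the relations in `Y` and cancel the common factor. What remains of the
leading side is still non-standard, so it keeps a full `c j`; nothing was cancelled there, and `j`
occurs in no `v i`. -/
theorem exists_forall_apply_eq_zero_of_box
    (hbox : ∀ u, u ∈ nonMinimalExponents ord a ↔ ∃ i, i ≠ r ∧ c i ≤ u i)
    {v : Fin m → Fin m →₀ ℕ}
    (hv : ∀ i, i ≠ r → Finsupp.weight a (v i) = Finsupp.weight a (Finsupp.single i (c i)) ∧
      v i ≺[ord] Finsupp.single i (c i))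
    {Y : Finset (Fin m)} (hY : Y.Nonempty) (hr : r ∉ Y) : ∃ j ∈ Y, ∀ i ∈ Y, v i j = 0 := by
  have hne : ∀ i ∈ Y, i ≠ r := fun i hi h => hr (h ▸ hi)
  set P : Fin m →₀ ℕ := ∑ i ∈ Y, Finsupp.single i (c i) with hP
  set Q : Fin m →₀ ℕ := ∑ i ∈ Y, v i with hQ
  have hw : Finsupp.weight a Q = Finsupp.weight a P := by
    rw [hP, hQ, map_sum, map_sum]
    exact Finset.sum_congr rfl fun i hi => (hv i (hne i hi)).1
  have hlt : Q ≺[ord] P := by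
    rw [hP, hQ, map_sum, map_sum]
    exact Finset.sum_lt_sum_of_nonempty hY fun i hi => (hv i (hne i hi)).2
  have hPsub : P - Q + P ⊓ Q = P := by
    ext i
    simp only [Finsupp.coe_add, Finsupp.coe_tsub, Pi.add_apply, Pi.sub_apply, Finsupp.inf_apply]
    omega
  have hQsub : Q - P + P ⊓ Q = Q := by
    ext i
    simp only [Finsupp.coe_add, Finsupp.coe_tsub, Pi.add_apply, Pi.sub_apply, Finsupp.inf_apply]
    omega
  have hmem : P - Q ∈ nonMinimalExponents ord a := by
    refine ⟨Q - P, ?_, ?_⟩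
    · refine add_right_cancel (b := Finsupp.weight a (P ⊓ Q)) ?_
      rw [← map_add, ← map_add, hPsub, hQsub, hw]
    · refine lt_of_add_lt_add_right (a := ord.toSyn (P ⊓ Q)) ?_
      rwa [← map_add, ← map_add, hPsub, hQsub]
  obtain ⟨j, hj, hle⟩ := (hbox _).1 hmem
  have hcj : c j ≠ 0 := by
    intro h
    exact zero_notMem_nonMinimalExponents ord a ((hbox 0).2 ⟨j, hj, by simp [h]⟩)
  have hPj : P j = if j ∈ Y then c j else 0 := by
    rw [hP, Finsupp.finsetSum_apply]
    simp [Finsupp.single_apply]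
  rw [Finsupp.tsub_apply, hPj] at hle
  split_ifs at hle with hjY
  · refine ⟨j, hjY, fun i hi => ?_⟩
    have : Q j = 0 := by omega
    rw [hQ, Finsupp.finsetSum_apply, Finset.sum_eq_zero_iff] at this
    exact this i hi
  · omega

theorem lcm_mem_closure_of_box (ha : ∀ i, 0 < a i)
    (hbox : ∀ u, u ∈ nonMinimalExponents ord a ↔ ∃ i, i ≠ r ∧ c i ≤ u i)
    {v : Fin m → Fin m →₀ ℕ}
    (hv : ∀ i, i ≠ r → Finsupp.weight a (v i) = Finsupp.weight a (Finsupp.single i (c i)) ∧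
      v i ≺[ord] Finsupp.single i (c i))
    {T : Finset (Fin m)} {k : Fin m} (hrT : r ∈ T) (hkT : k ∉ T)
    (hvk : ∀ j, v k j ≠ 0 → j ∈ T) (hvT : ∀ i ∈ T, i ≠ r → ∀ j, v i j ≠ 0 → j ∈ T) :
    Nat.lcm (a k) (T.gcd a) ∈ AddSubmonoid.closure (a '' (T : Set (Fin m))) := by
  have hkr : k ≠ r := fun h => hkT (h ▸ hrT)
  have hmem : c k * a k ∈ AddSubmonoid.closure (a '' (T : Set (Fin m))) := by
    have h := weight_mem_closure (a := a) (T := (T : Set (Fin m))) hvk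
    rwa [(hv k hkr).1, Finsupp.weight_single, smul_eq_mul] at h
  have hgcd : T.gcd a ∣ c k * a k := by
    obtain ⟨w, hw, hwk⟩ := exists_weight_eq_of_mem_closure hmem
    rw [← hwk, Finsupp.weight_apply]
    exact Finset.dvd_sum fun i hi =>
      (Finset.gcd_dvd (hw i (Finsupp.mem_support_iff.1 hi))).mul_left _
  obtain ⟨n, hn⟩ := Nat.dvd_lcm_left (a k) (T.gcd a)
  have hle : n ≤ c k := by
    refine Nat.le_of_mul_le_mul_left ?_ (ha k)
    rw [← hn, mul_comm (a k)]
    refine Nat.le_of_dvd (Nat.mul_pos (Nat.pos_of_ne_zero fun h => ?_) (ha k))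
      (Nat.lcm_dvd (dvd_mul_left _ _) hgcd)
    exact zero_notMem_nonMinimalExponents ord a ((hbox 0).2 ⟨k, hkr, by simp [h]⟩)
  rcases hle.eq_or_lt with rfl | hlt
  · rwa [hn, mul_comm]
  exfalso
  have hn0 : n ≠ 0 := by
    rintro rfl
    rw [mul_zero, Nat.lcm_eq_zero_iff, Finset.gcd_eq_zero_iff] at hn
    rcases hn with h | h
    · exact (ha k).ne' h
    · exact (ha r).ne' (h r hrT)
  obtain ⟨N, hN⟩ := exists_add_mul_mem_closure hrT (ha r) (Nat.dvd_lcm_right (a k) (T.gcd a))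
  obtain ⟨w, ⟨hwT, hww⟩, hwmin⟩ := ord.exists_minimal (exists_weight_eq_of_mem_closure hN)
  -- Otherwise some corner `c j` with `j ∈ T` could be replaced by `v j`, staying inside `T` and
  -- contradicting the choice of `w`.
  have hw : w ∉ nonMinimalExponents ord a := by
    intro hw
    obtain ⟨j, hjr, hj⟩ := (hbox w).1 hw
    have hjT : j ∈ T := by
      refine hwT j fun h => zero_notMem_nonMinimalExponents ord a ((hbox 0).2 ⟨j, hjr, ?_⟩)
      rw [h] at hj
      exact hj
    obtain ⟨d, rfl⟩ := exists_add_of_le (Finsupp.single_le_iff.2 hj)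
    refine hwmin (v j + d) ⟨fun i hi => ?_, ?_⟩ ?_
    · by_cases h : v j i = 0
      · refine hwT i fun h0 => hi ?_
        rw [Finsupp.add_apply] at h0 ⊢
        omega
      · exact hvT j hjT hjr i h
    · rw [← hww, map_add, map_add, (hv j hjr).1]
    · rw [map_add, map_add]
      exact add_lt_add_left (hv j hjr).2 _
  -- As `n < c k` and coordinate `r` is unrestricted, `u` is standard of the same weight as `w`; yet
  -- `u` involves `k ∉ T`.
  set u : Fin m →₀ ℕ := Finsupp.single k n + Finsupp.single r N with hu
  have huL : u ∉ nonMinimalExponents ord a := by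
    rw [hbox]
    rintro ⟨i, hi, hle⟩
    by_cases hik : i = k
    · subst hik
      simp [hu, Finsupp.single_eq_of_ne hi] at hle
      omega
    · rw [hu, Finsupp.add_apply, Finsupp.single_eq_of_ne hi, Finsupp.single_eq_of_ne hik] at hle
      refine zero_notMem_nonMinimalExponents ord a ((hbox 0).2 ⟨i, hi, ?_⟩)
      simpa using hle
  have huw : u = w := by
    by_contra hne
    refine (mem_or_mem_nonMinimalExponents (ord := ord) (a := a) ?_ hne).elim huL hw
    rw [hww, hu, map_add, Finsupp.weight_single, Finsupp.weight_single, hn, smul_eq_mul,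
      smul_eq_mul, mul_comm (a k)]
  refine hkT (hwT k ?_)
  rw [← huw, hu, Finsupp.add_apply, Finsupp.single_eq_same]
  omega

theorem Fin.exists_perm_lt_of_wellFounded {U : Fin m → Fin m → Prop} (hU : WellFounded U) :
    ∃ e : Fin m ≃ Fin m, ∀ i j, U (e i) (e j) → i < j := by
  have : IsWellFounded (Fin m) U := ⟨hU⟩
  refine ⟨Tuple.sort (IsWellFounded.rank U), fun i j hij => ?_⟩
  by_contra! hji
  exact (IsWellFounded.rank_lt_of_rel hij).not_ge
    (Tuple.monotone_sort (IsWellFounded.rank U) hji)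

theorem exists_isFreeArrangement_of_box (ha : ∀ i, 0 < a i)
    (hbox : ∀ u, u ∈ nonMinimalExponents ord a ↔ ∃ i, i ≠ r ∧ c i ≤ u i) :
    ∃ e : Fin m ≃ Fin m, IsFreeArrangement (a ∘ e) := by
  classical
  have hex : ∀ i, ∃ v : Fin m →₀ ℕ, i ≠ r →
      Finsupp.weight a v = Finsupp.weight a (Finsupp.single i (c i)) ∧
        v ≺[ord] Finsupp.single i (c i) := by
    intro i
    by_cases hi : i = r
    · exact ⟨0, fun h => absurd hi h⟩
    · obtain ⟨v, hv⟩ := (hbox (Finsupp.single i (c i))).2 ⟨i, hi, by simp⟩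
      exact ⟨v, fun _ => hv⟩
  choose v hv using hex
  -- The clause `j = r` forces `r` to the last position.
  let U : Fin m → Fin m → Prop := fun i j => i ≠ r ∧ (v i j ≠ 0 ∨ j = r)
  have hU : WellFounded U := by
    rw [WellFounded.wellFounded_iff_has_min]
    intro Y hY
    by_cases h : ((Y \ {r}).toFinset).Nonempty
    · obtain ⟨j, hj, hjv⟩ := exists_forall_apply_eq_zero_of_box hbox hv h (by simp)
      simp only [Set.mem_toFinset, Set.mem_sdiff, Set.mem_singleton_iff] at hj hjv
      exact ⟨j, hj.1, fun i hi hij => hij.2.elim (fun h => h (hjv i ⟨hi, hij.1⟩)) hj.2⟩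
    · have hsub : ∀ i ∈ Y, i = r := by
        intro i hi
        by_contra hne
        exact h ⟨i, by simp [hi, hne]⟩
      obtain ⟨j, hj⟩ := hY
      exact ⟨j, hj, fun i hi hij => hij.1 (hsub i hi)⟩
  obtain ⟨e, he⟩ := Fin.exists_perm_lt_of_wellFounded hU
  refine ⟨e, fun i hi => ?_⟩
  have hlast : ∀ j, e j ≠ r → j < e.symm r := fun j hj => he j _ ⟨hj, Or.inr (by simp)⟩
  have hir : e i ≠ r := by
    intro h
    have h1 := hlast ⟨i + 1, hi⟩ fun h' => by
      have := congrArg Fin.val (e.injective (h'.trans h.symm))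
      simp at this
    rw [← h, e.symm_apply_apply, Fin.lt_def] at h1
    simp at h1
  have huse : ∀ j, e j ≠ r → ∀ l, v (e j) l ≠ 0 → j < e.symm l :=
    fun j hj l hl => he j _ ⟨hj, Or.inl (by simpa using hl)⟩
  have key := lcm_mem_closure_of_box (T := (Finset.Ioi i).map e.toEmbedding) (k := e i) ha hbox hv
    (by simpa [Finset.mem_map_equiv] using hlast i hir) (by simp)
    (fun j hj => by simpa [Finset.mem_map_equiv] using huse i hir j hj)
    (fun l hl hlr j hj => by
      rw [Finset.mem_map_equiv, Finset.mem_Ioi] at hl ⊢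
      exact hl.trans (huse (e.symm l) (by simpa using hlr) j (by simpa using hj)))
  have hgcd : (Finset.Ioi i).gcd (a ∘ e) = ((Finset.Ioi i).map e.toEmbedding).gcd a := by
    rw [Finset.map_eq_image, Finset.gcd_image]
    rfl
  rw [hgcd, Set.image_comp]
  simpa using key

theorem exists_isFreeArrangement_of_span_eq {K : Type*} [Field K] (ha : ∀ i, 0 < a i)
    {s : Finset (MvPolynomial (Fin m) K)}
    (hs : Ideal.span (s : Set (MvPolynomial (Fin m) K)) = initialIdeal ord (toricIdeal K a))
    (hcard : s.card + 1 ≤ m) :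
    ∃ e : Fin m ≃ Fin m, IsFreeArrangement (a ∘ e) := by
  obtain ⟨r, hr⟩ := exists_single_notMem_nonMinimalExponents (ord := ord) (by omega) ha
  obtain ⟨c, hc⟩ := exists_box ha hr hs hcard
  exact exists_isFreeArrangement_of_box ha hc

end Box

/-! ### From a free arrangement to a box -/

section LexOrder

/-- The lexicographic order in which the variables decrease along the arrangement `e`. -/
noncomputable def MonomialOrder.lexOfEquiv {m : ℕ} (e : Fin m ≃ Fin m) :
    MonomialOrder.{0, 0} (Fin m) where
  syn := Lex (Fin m →₀ ℕ)
  toSyn := (Finsupp.domCongr e.symm).trans { toEquiv := toLex, map_add' := toLex_add }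
  toSyn_monotone := fun u v huv => by
    refine Finsupp.toLex_monotone fun i => ?_
    exact huv (e i)

theorem MonomialOrder.lexOfEquiv_lt_iff {m : ℕ} {e : Fin m ≃ Fin m} {u v : Fin m →₀ ℕ} :
    u ≺[lexOfEquiv e] v ↔ ∃ i, (∀ j < i, u (e j) = v (e j)) ∧ u (e i) < v (e i) := by
  change toLex (Finsupp.domCongr e.symm u) < toLex (Finsupp.domCongr e.symm v) ↔ _
  rw [Finsupp.Lex.lt_iff]
  simp

variable {n : ℕ} {a : Fin (n + 1) → ℕ} {e : Fin (n + 1) ≃ Fin (n + 1)}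

theorem mem_nonMinimalExponents_lexOfEquiv_of_isFreeArrangement (ha : ∀ i, 0 < a i)
    (he : IsFreeArrangement (a ∘ e)) :
    ∃ c : Fin (n + 1) → ℕ, ∀ u, u ∈ nonMinimalExponents (lexOfEquiv e) a ↔
      ∃ i ∈ Finset.univ.erase (e (Fin.last n)), c i ≤ u i := by
  let g : Fin (n + 1) → ℕ := fun i => (Finset.Ioi i).gcd (a ∘ e)
  have hdvd : ∀ k, a k ∣ Nat.lcm (a k) (g (e.symm k)) := fun k => Nat.dvd_lcm_left _ _
  -- At the last position the gcd is empty, so the lcm and `c` are `0`; that index is excluded from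
  -- the box.
  choose c hc using hdvd
  refine ⟨c, fun u => ⟨?_, ?_⟩⟩
  · rintro ⟨v, hw, hlt⟩
    obtain ⟨i, heq, hi⟩ := lexOfEquiv_lt_iff.1 hlt
    -- Split at the first difference `i`: earlier terms cancel, and `(u - v) * a` at `e i` is
    -- divisible by the gcd of the later weights, hence by the lcm.
    have hsum : ∀ w : Fin (n + 1) →₀ ℕ, Finsupp.weight a w =
        ∑ j ∈ Finset.Iio i, w (e j) * a (e j) + w (e i) * a (e i) +
          ∑ j ∈ Finset.Ioi i, w (e j) * a (e j) := by
      intro w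
      rw [Finsupp.weight_apply, Finsupp.sum_fintype _ _ (by simp),
        ← Equiv.sum_comp e (fun j => w j • a j)]
      simp only [smul_eq_mul]
      have h1 : (Finset.univ : Finset (Fin (n + 1))) =
          insert i (Finset.Iio i ∪ Finset.Ioi i) := by
        ext j
        simp only [Finset.mem_univ, Finset.mem_insert, Finset.mem_union, Finset.mem_Iio,
          Finset.mem_Ioi, true_iff]
        rcases lt_trichotomy j i with h | h | h <;> simp [h]
      rw [h1, Finset.sum_insert (by simp), Finset.sum_union ?_]
      · ring
      · rw [Finset.disjoint_left]
        intro j hj hj'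
        exact absurd (Finset.mem_Iio.1 hj) (Finset.mem_Ioi.1 hj').not_gt
    rw [hsum, hsum, Finset.sum_congr rfl (fun j hj => by rw [heq j (Finset.mem_Iio.1 hj)])] at hw
    have hgdvd : ∀ w : Fin (n + 1) →₀ ℕ, g i ∣ ∑ j ∈ Finset.Ioi i, w (e j) * a (e j) :=
      fun w => Finset.dvd_sum fun j hj => (Finset.gcd_dvd (f := a ∘ e) hj).mul_left _
    have hsub : (u (e i) - v (e i)) * a (e i) + ∑ j ∈ Finset.Ioi i, u (e j) * a (e j) =
        ∑ j ∈ Finset.Ioi i, v (e j) * a (e j) := by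
      obtain ⟨d, hd⟩ := Nat.exists_eq_add_of_lt hi
      rw [hd] at hw ⊢
      rw [show v (e i) + d + 1 - v (e i) = d + 1 by omega]
      linarith
    have hg : g i ∣ (u (e i) - v (e i)) * a (e i) :=
      (Nat.dvd_add_left (hgdvd u)).1 (hsub ▸ hgdvd v)
    have hlcm : Nat.lcm (a (e i)) (g i) ∣ (u (e i) - v (e i)) * a (e i) :=
      Nat.lcm_dvd (dvd_mul_left _ _) hg
    have hpos : 0 < (u (e i) - v (e i)) * a (e i) := Nat.mul_pos (by omega) (ha _)
    refine ⟨e i, ?_, ?_⟩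
    · rw [Finset.mem_erase]
      refine ⟨fun h => ?_, Finset.mem_univ _⟩
      rw [e.injective h] at hsub hpos
      rw [show Finset.Ioi (Fin.last n) = ∅ by ext j; simp [Fin.le_last]] at hsub
      simp only [Finset.sum_empty, add_zero] at hsub
      omega
    · have hle := Nat.le_of_dvd hpos hlcm
      have hci := hc (e i)
      rw [e.symm_apply_apply] at hci
      rw [hci, mul_comm] at hle
      have := Nat.le_of_mul_le_mul_right hle (ha _)
      omega
  · rintro ⟨k, hk, hle⟩
    refine nonMinimalExponents_isUpperSet _ a (Finsupp.single_le_iff.2 hle) ?_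
    have hkl : e.symm k ≠ Fin.last n := fun h => by
      rw [← h] at hk
      simp at hk
    have hmem := he (e.symm k) (by
      have := Fin.lt_last_iff_ne_last.2 hkl
      rw [Fin.lt_def, Fin.val_last] at this
      omega)
    rw [Set.image_comp, Function.comp_apply, e.apply_symm_apply] at hmem
    obtain ⟨v, hv, hvw⟩ := exists_weight_eq_of_mem_closure hmem
    have hv' : ∀ j, j ≤ e.symm k → v (e j) = 0 := by
      intro j hj
      by_contra h
      obtain ⟨l, hl, hlj⟩ := hv _ h
      rw [e.injective hlj] at hl
      exact hj.not_gt hl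
    have hc0 : c k ≠ 0 := by
      intro h
      have hck := hc k
      rw [h, mul_zero, Nat.lcm_eq_zero_iff, Finset.gcd_eq_zero_iff] at hck
      rcases hck with h | h
      · exact (ha k).ne' h
      · exact (ha _).ne' (h (Fin.last n) (Finset.mem_Ioi.2 (Fin.lt_last_iff_ne_last.2 hkl)))
    refine ⟨v, ?_, lexOfEquiv_lt_iff.2 ⟨e.symm k, fun j hj => ?_, ?_⟩⟩
    · rw [hvw, Finsupp.weight_single, smul_eq_mul, mul_comm]
      exact hc k
    · rw [hv' j hj.le, Finsupp.single_eq_of_ne]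
      exact fun h => hj.ne (by rw [← h, e.symm_apply_apply])
    · rw [hv' _ le_rfl, e.apply_symm_apply, Finsupp.single_eq_same]
      exact Nat.pos_of_ne_zero hc0

end LexOrder

/-! ### Initial ideals generated by pure powers -/

section PureBox

variable {K : Type*} [Field K] {m : ℕ} {ord : MonomialOrder (Fin m)} {a c : Fin m → ℕ}
  {T : Finset (Fin m)}

theorem initialIdeal_eq_span_monomial_single
    (hbox : ∀ u, u ∈ nonMinimalExponents ord a ↔ ∃ i ∈ T, c i ≤ u i) :
    initialIdeal ord (toricIdeal K a) =
      Ideal.span ((fun i => monomial (Finsupp.single i (c i)) (1 : K)) '' (T : Set (Fin m))) := by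
  rw [initialIdeal_toricIdeal]
  refine le_antisymm ?_ (Ideal.span_le.2 ?_)
  · intro f hf
    rw [(nonMinimalExponents_isUpperSet ord a).mem_span_monomial_iff] at hf
    have : (fun i => monomial (Finsupp.single i (c i)) (1 : K)) '' (T : Set (Fin m)) =
        (fun u => monomial u (1 : K)) '' ((fun i => Finsupp.single i (c i)) '' (T : Set (Fin m))) := by
      rw [Set.image_image]
    rw [this, mem_ideal_span_monomial_image]
    intro u hu
    obtain ⟨i, hi, hle⟩ := (hbox u).1 (hf u hu)
    exact ⟨_, ⟨i, hi, rfl⟩, Finsupp.single_le_iff.2 hle⟩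
  · rintro _ ⟨i, hi, rfl⟩
    exact Ideal.subset_span ⟨_, (hbox _).2 ⟨i, hi, by simp⟩, rfl⟩

theorem ne_zero_of_box (hbox : ∀ u, u ∈ nonMinimalExponents ord a ↔ ∃ i ∈ T, c i ≤ u i)
    {i : Fin m} (hi : i ∈ T) : c i ≠ 0 := fun h =>
  zero_notMem_nonMinimalExponents ord a ((hbox 0).2 ⟨i, hi, by simp [h]⟩)

theorem Finsupp.injOn_single_of_ne_zero {σ : Type*} {T : Set σ} {c : σ → ℕ}
    (hc : ∀ i ∈ T, c i ≠ 0) : Set.InjOn (fun i => Finsupp.single i (c i)) T := by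
  intro i hi j _ h
  rcases (Finsupp.single_eq_single_iff ..).1 h with ⟨h, _⟩ | ⟨h, _⟩
  · exact h
  · exact absurd h (hc i hi)

theorem isCompleteIntersection_initialIdeal_of_box
    (hbox : ∀ u, u ∈ nonMinimalExponents ord a ↔ ∃ i ∈ T, c i ≤ u i) :
    IsCompleteIntersection (initialIdeal ord (toricIdeal K a)) := by
  classical
  refine ⟨T.image fun i => monomial (Finsupp.single i (c i)) (1 : K), ?_, ?_⟩
  · rw [initialIdeal_eq_span_monomial_single hbox, Finset.coe_image]
  · rw [initialIdeal_eq_span_monomial_single hbox,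
      height_span_monomial_single T c fun i hi => ne_zero_of_box hbox hi,
      Finset.card_image_of_injOn]
    exact (monomial_left_injective one_ne_zero).comp_injOn
      (Finsupp.injOn_single_of_ne_zero fun i hi => ne_zero_of_box hbox hi)

theorem exists_isGroebnerBasis_of_box
    (hbox : ∀ u, u ∈ nonMinimalExponents ord a ↔ ∃ i ∈ T, c i ≤ u i) :
    ∃ G : Finset (MvPolynomial (Fin m) K),
      IsGroebnerBasis ord (toricIdeal K a) (G : Set (MvPolynomial (Fin m) K)) ∧
        G.card = T.card := by
  classical
  have hex : ∀ i, ∃ v, i ∈ T → Finsupp.weight a v = Finsupp.weight a (Finsupp.single i (c i)) ∧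
      v ≺[ord] Finsupp.single i (c i) := by
    intro i
    by_cases hi : i ∈ T
    · obtain ⟨v, hv⟩ := (hbox (Finsupp.single i (c i))).2 ⟨i, hi, by simp⟩
      exact ⟨v, fun _ => hv⟩
    · exact ⟨0, fun h => absurd h hi⟩
  choose v hv using hex
  let b : Fin m → MvPolynomial (Fin m) K :=
    fun i => monomial (Finsupp.single i (c i)) 1 - monomial (v i) 1
  refine ⟨T.image b, ⟨?_, ?_⟩, ?_⟩
  · rw [Finset.coe_image]
    rintro _ ⟨i, hi, rfl⟩
    exact monomial_sub_monomial_mem_toricIdeal (hv i hi).1.symm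
  · rw [initialIdeal_eq_span_monomial_single hbox, Finset.coe_image, Set.image_image]
    congr 1
    exact Set.image_congr fun i hi => ord.leadingTerm_monomial_sub_monomial (hv i hi).2
  · refine Finset.card_image_of_injOn fun i hi j hj hij => ?_
    refine Finsupp.injOn_single_of_ne_zero (T := (T : Set (Fin m)))
      (fun i hi => ne_zero_of_box hbox hi) hi hj ?_
    have h := congrArg ord.degree hij
    simp only [b] at h
    rwa [ord.degree_monomial_sub_monomial (hv i hi).2,
      ord.degree_monomial_sub_monomial (hv j hj).2] at h

end PureBox

/-- Every monomial order on `m` variables is isomorphic to one in universe `0`, so the monomial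
orders below are all monomial orders. -/
theorem theorem4p8 (K : Type*) [Field K] (S : AddSubmonoid ℕ) (hS : IsNumericalSemigroup S)
    (m : ℕ) (a : Fin m → ℕ) (ha : IsMinGenArrangement S a) :
    (IsFreeSemigroup S ↔
      ∃ (ord : MonomialOrder.{0, 0} (Fin m)) (G : Finset (MvPolynomial (Fin m) K)),
        IsGroebnerBasis ord (toricIdeal K a) (G : Set (MvPolynomial (Fin m) K)) ∧
          G.card + 1 = m) ∧
    (IsFreeSemigroup S ↔
      ∃ ord : MonomialOrder.{0, 0} (Fin m),
        IsCompleteIntersection (initialIdeal ord (toricIdeal K a))) := by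
  rw [isFreeSemigroup_iff ha]
  have hpos := ha.pos
  have hm := hS.pos_of_isMinGenArrangement ha
  have hbox : ∀ e : Fin m ≃ Fin m, IsFreeArrangement (a ∘ e) →
      ∃ (ord : MonomialOrder.{0, 0} (Fin m)) (T : Finset (Fin m)) (c : Fin m → ℕ),
        T.card + 1 = m ∧ ∀ u, u ∈ nonMinimalExponents ord a ↔ ∃ i ∈ T, c i ≤ u i := by
    intro e he
    obtain ⟨n, rfl⟩ := Nat.exists_eq_add_one.2 hm
    obtain ⟨c, hc⟩ := mem_nonMinimalExponents_lexOfEquiv_of_isFreeArrangement hpos he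
    exact ⟨_, _, c, by simp, hc⟩
  refine ⟨⟨?_, ?_⟩, ⟨?_, ?_⟩⟩
  · rintro ⟨e, he⟩
    obtain ⟨ord, T, c, hT, hc⟩ := hbox e he
    obtain ⟨G, hG, hcard⟩ := exists_isGroebnerBasis_of_box (K := K) hc
    exact ⟨ord, G, hG, by omega⟩
  · classical
    rintro ⟨ord, G, hG, hcard⟩
    have hle := Finset.card_image_le (s := G) (f := ord.leadingTerm)
    refine exists_isFreeArrangement_of_span_eq (ord := ord) hpos (s := G.image ord.leadingTerm) ?_
      (by omega)
    rw [Finset.coe_image]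
    exact hG.2
  · rintro ⟨e, he⟩
    obtain ⟨ord, T, c, hT, hc⟩ := hbox e he
    exact ⟨ord, isCompleteIntersection_initialIdeal_of_box hc⟩
  · rintro ⟨ord, s, hs, hcard⟩
    obtain ⟨r, hr⟩ := exists_single_notMem_nonMinimalExponents (ord := ord) hm hpos
    refine exists_isFreeArrangement_of_span_eq hpos hs ?_
    have h := height_initialIdeal_add_one_le (K := K) hr
    rw [← hcard] at h
    exact_mod_cast h
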